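/- Let $\mathbb k$ be a field, let $R$ be a noetherian commutative $\mathbb k$-algebra, and let $G$ be a finite group, with $|G|$ invertible in $\mathbb k$, acting on $R$ by $\mathbb k$-algebra automorphisms. Let $A = R^G$ be the invariant subalgebra, and let $B = R * G$ be the skew group algebra, that is, the free left $R$-module on $G$ with multiplication $(r g)(s h) = r\,g(s)\,gh$. Let $\mathfrak r = \mathfrak r(R,G)$ be the $G$-radical of $R$, i.e. the ideal of all sums $\sum_{i=1}^n a_i b_i$ with $n \ge 1$, where $a_1,\dots,a_n,b_1,\dots,b_n \in R$ satisfy $\sum_{i=1}^n a_i\, g(b_i) = 0$ for all $1 \ne g \in G$. Put $\mathfrak a = \mathfrak r \cap A$, an ideal of $A$, and $\mathfrak b = \mathfrak r \otimes \mathbb k G = \{\sum_g r_g g : r_g \in \mathfrak r\}$, an ideal of $B$. For a right noetherian algebra $S$ and a two-sided ideal $I$ of $S$, a right $S$-module $M$ is called $I$-torsion if for every $m \in M$ there is an $n$ with $m I^n = 0$. Let $\operatorname{QMod}_I S = \operatorname{Mod} S / \operatorname{Tor}_I S$ be the quotient of the abelian category of right $S$-modules by the Serre subcategory of $I$-torsion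 modules. Regard $R$ as a $B$-$A$-bimodule via $(r g)\cdot x\cdot a = r\,g(x)\,a$. The functor $-\otimes_B R : \operatorname{Mod} B \to \operatorname{Mod} A$ induces a functor $-\otimes_{\mathcal B} \mathcal R : \operatorname{QMod}_{\mathfrak b} B \to \operatorname{QMod}_{\mathfrak a} A$. The ideals $\mathfrak a$ and $\mathfrak r$ are called cofinal if $\mathfrak a R = R \mathfrak a$ and the filtrations $(\mathfrak a^n R)_{n \ge 0}$ and $(\mathfrak r^n)_{n \ge 0}$ of $R$ are cofinal, i.e. for each $s$ there is an $n$ with $\mathfrak r^n \subseteq \mathfrak a^s R$, and for each $s$ there is an $n$ with $\mathfrak a^n R \subseteq \mathfrak r^s$. Then the following are equivalent. (i) The functor $-\otimes_{\mathcal B} \mathcal R : \operatorname{QMod}_{\mathfrak b} B \to \operatorname{QMod}_{\mathfrak a} A$ is an equivalence of abelian categories. (ii) The ideals $\mathfrak a$ of $A$ and $\mathfrak r$ of $R$ are cofinal. -/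

import Mathlib

open CategoryTheory

universe w u v

set_option linter.unusedSectionVars false

namespace GRadical

/-! ### Torsion modules and the quotient category `QMod` -/

section Torsion

variable {S : Type u} [Ring S]

/-- The `I`-torsion right `S`-modules (right `S`-modules are modules over `Sᵐᵒᵖ`): every `m : M`
satisfies `m Iⁿ = 0` for some `n`, that is, `Γ_I(M) = colim Hom_S(S/Iⁿ, M)` is all of `M`. -/
def torsion (I : Ideal S) : ObjectProperty (ModuleCat.{w} Sᵐᵒᵖ) :=
  fun M => ∀ m : M, ∃ n : ℕ, ∀ x ∈ I ^ n, MulOpposite.op x • m = 0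

theorem torsion_extension_aux (I : Ideal S) [I.IsTwoSided] [IsNoetherianRing Sᵐᵒᵖ]
    {M : Type w} [AddCommGroup M] [Module Sᵐᵒᵖ M] (m : M) (n : ℕ)
    (h : ∀ y ∈ I ^ n, ∃ l : ℕ, ∀ z ∈ I ^ l, MulOpposite.op z • MulOpposite.op y • m = 0) :
    ∃ l : ℕ, ∀ x ∈ I ^ l, MulOpposite.op x • m = 0 := by
  let J : Ideal Sᵐᵒᵖ :=
    { carrier := {t | t.unop ∈ I ^ n}
      add_mem' := fun ha hb => add_mem (s := I ^ n) ha hb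
      zero_mem' := (I ^ n).zero_mem
      smul_mem' := fun c t ht => (I ^ n).mul_mem_right c.unop ht }
  obtain ⟨T, hT⟩ := (isNoetherianRing_iff_ideal_fg Sᵐᵒᵖ).1 inferInstance J
  have h' : ∀ t : Sᵐᵒᵖ, ∃ l : ℕ, t ∈ T → ∀ z ∈ I ^ l, MulOpposite.op z • t • m = 0 := by
    intro t
    by_cases ht : t ∈ T
    · have htJ : t ∈ J := hT ▸ Ideal.subset_span ht
      obtain ⟨l, hl⟩ := h t.unop htJ
      exact ⟨l, fun _ => hl⟩
    · exact ⟨0, fun h => absurd h ht⟩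
  choose l hl using h'
  have key : ∀ t ∈ J, ∀ z ∈ I ^ (T.sup l), MulOpposite.op z • t • m = 0 := by
    intro t ht
    rw [← hT] at ht
    induction ht using Submodule.span_induction with
    | mem t ht => exact fun z hz => hl t ht z (Ideal.pow_le_pow_right (Finset.le_sup ht) hz)
    | zero => simp
    | add a b _ _ ha hb => intro z hz; rw [add_smul, smul_add, ha z hz, hb z hz, add_zero]
    | smul c t _ ht =>
      intro z hz
      have := ht (c.unop * z) ((I ^ _).mul_mem_left _ hz)
      rwa [MulOpposite.op_mul, MulOpposite.op_unop, mul_smul, smul_smul c t m] at this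
  refine ⟨n + T.sup l, fun x hx => ?_⟩
  rw [Ideal.IsTwoSided.pow_add] at hx
  induction hx using Submodule.mul_induction_on' with
  | mem_mul_mem y hy z hz =>
    rw [MulOpposite.op_mul, mul_smul]
    exact key (MulOpposite.op y) hy z hz
  | add a _ b _ ha hb => rw [MulOpposite.op_add, add_smul, ha, hb, add_zero]

/-- Over a right noetherian ring the `I`-torsion modules form a Serre class. -/
instance torsion_isSerreClass (I : Ideal S) [I.IsTwoSided] [IsNoetherianRing Sᵐᵒᵖ] :
    (torsion.{w} I).IsSerreClass where
  exists_zero := ⟨ModuleCat.of Sᵐᵒᵖ PUnit, ModuleCat.isZero_of_subsingleton _,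
    fun _ => ⟨0, fun _ _ => Subsingleton.elim _ _⟩⟩
  prop_of_mono {X Y} f _ hY m := by
    obtain ⟨n, hn⟩ := hY (f m)
    refine ⟨n, fun x hx => (ModuleCat.mono_iff_injective f).1 inferInstance ?_⟩
    simpa using hn x hx
  prop_of_epi {X Y} f _ hX y := by
    obtain ⟨m, rfl⟩ := (ModuleCat.epi_iff_surjective f).1 inferInstance y
    obtain ⟨n, hn⟩ := hX m
    exact ⟨n, fun x hx => by rw [← map_smul, hn x hx, map_zero]⟩
  prop_X₂_of_shortExact {E} hE h₁ h₃ m := by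
    obtain ⟨n, hn⟩ := h₃ (E.g m)
    refine torsion_extension_aux I m n fun y hy => ?_
    have h0 : E.g (MulOpposite.op y • m) = 0 := by rw [map_smul, hn y hy]
    obtain ⟨a, ha⟩ := (ShortComplex.moduleCat_exact_iff E).1 hE.exact _ h0
    obtain ⟨l, hl⟩ := h₁ a
    exact ⟨l, fun z hz => by rw [← ha, ← map_smul, hl z hz, map_zero]⟩

/-- `QMod_I S = Mod S / Tor_I S`: the Serre quotient, that is, the localization of the category of
right `S`-modules at the morphisms whose kernel and cokernel are `I`-torsion. -/
abbrev QMod (S : Type u) [Ring S] (I : Ideal S) [I.IsTwoSided] [IsNoetherianRing Sᵐᵒᵖ] :=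
  (torsion.{w} I).isoModSerre.Localization

/-- The projection functor `π : Mod S ⥤ QMod_I S`. -/
abbrev QMod.π (S : Type u) [Ring S] (I : Ideal S) [I.IsTwoSided] [IsNoetherianRing Sᵐᵒᵖ] :
    ModuleCat.{w} Sᵐᵒᵖ ⥤ QMod.{w} S I :=
  (torsion.{w} I).isoModSerre.Q

/-- `QMod_I S` is an abelian category. -/
noncomputable instance QMod.abelian (S : Type u) [Ring S] (I : Ideal S) [I.IsTwoSided]
    [IsNoetherianRing Sᵐᵒᵖ] : Abelian (QMod.{w} S I) :=
  ObjectProperty.SerreClassLocalization.abelian (QMod.π S I) (torsion.{w} I)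

theorem isoModSerre_torsion_iff (I : Ideal S) [I.IsTwoSided] [IsNoetherianRing Sᵐᵒᵖ]
    {M N : ModuleCat.{w} Sᵐᵒᵖ} (f : M ⟶ N) :
    (torsion.{w} I).isoModSerre f ↔
      (∀ m : M, f m = 0 → ∃ n : ℕ, ∀ x ∈ I ^ n, MulOpposite.op x • m = 0) ∧
      (∀ y : N, ∃ n : ℕ, ∀ x ∈ I ^ n, ∃ m : M, f m = MulOpposite.op x • y) := by
  rw [ObjectProperty.isoModSerre_iff, ObjectProperty.monoModSerre_iff,
    ObjectProperty.epiModSerre_iff,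
    (torsion.{w} I).prop_iff_of_iso (ModuleCat.kernelIsoKer f),
    (torsion.{w} I).prop_iff_of_iso (ModuleCat.cokernelIsoRangeQuotient f)]
  refine and_congr ⟨fun h m hm => ?_, fun h m => ?_⟩ ⟨fun h y => ?_, fun h y => ?_⟩
  · obtain ⟨n, hn⟩ := h ⟨m, hm⟩
    exact ⟨n, fun x hx => congrArg Subtype.val (hn x hx)⟩
  · obtain ⟨n, hn⟩ := h m.1 m.2
    exact ⟨n, fun x hx => Subtype.ext (hn x hx)⟩
  · obtain ⟨n, hn⟩ := h (Submodule.Quotient.mk y)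
    refine ⟨n, fun x hx => ?_⟩
    have := hn x hx
    rw [← Submodule.Quotient.mk_smul, Submodule.Quotient.mk_eq_zero] at this
    exact this
  · obtain ⟨y, rfl⟩ := Submodule.Quotient.mk_surjective _ y
    obtain ⟨n, hn⟩ := h y
    refine ⟨n, fun x hx => ?_⟩
    rw [← Submodule.Quotient.mk_smul, Submodule.Quotient.mk_eq_zero]
    exact hn x hx

end Torsion

/-! ### The tensor product over a noncommutative ring -/

section Tensor

variable (S : Type*) (T : Type*) [Ring S] [Ring T]
variable (X : Type u) [AddCommGroup X] [Module S X] [Module Tᵐᵒᵖ X]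

open TensorProduct

/-- The relations `m b ⊗ x = m ⊗ b x` in the tensor product over `ℤ` of a right `S`-module `M` and
an `S`-`T`-bimodule `X`. The factors are written in the opposite order, so that the right action
of `T` on `X` is the one that Mathlib puts on the tensor product. -/
def tensorRel [SMulCommClass S Tᵐᵒᵖ X] (M : Type w) [AddCommGroup M] [Module Sᵐᵒᵖ M] :
    Submodule Tᵐᵒᵖ (X ⊗[ℤ] M) :=
  Submodule.span Tᵐᵒᵖ
    {z | ∃ (b : S) (x : X) (m : M), z = (b • x) ⊗ₜ[ℤ] m - x ⊗ₜ[ℤ] (MulOpposite.op b • m)}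

variable [SMulCommClass S Tᵐᵒᵖ X]

/-- The right `T`-module `M ⊗_S X`. -/
abbrev BalancedTensor (M : Type w) [AddCommGroup M] [Module Sᵐᵒᵖ M] : Type (max u w) :=
  (X ⊗[ℤ] M) ⧸ tensorRel S T X M

/-- The map `f ⊗_S X`. -/
noncomputable def balancedMap {M N : Type w} [AddCommGroup M] [Module Sᵐᵒᵖ M] [AddCommGroup N]
    [Module Sᵐᵒᵖ N] (f : M →ₗ[Sᵐᵒᵖ] N) :
    BalancedTensor S T X M →ₗ[Tᵐᵒᵖ] BalancedTensor S T X N :=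
  Submodule.mapQ _ _ (AlgebraTensorModule.lTensor Tᵐᵒᵖ X f.toAddMonoidHom.toIntLinearMap) <| by
    rw [tensorRel, Submodule.span_le]
    rintro _ ⟨b, x, m, rfl⟩
    refine Submodule.subset_span ⟨b, x, f m, ?_⟩
    simp

theorem balancedMap_mk_tmul {M N : Type w} [AddCommGroup M] [Module Sᵐᵒᵖ M] [AddCommGroup N]
    [Module Sᵐᵒᵖ N] (f : M →ₗ[Sᵐᵒᵖ] N) (x : X) (m : M) :
    balancedMap S T X f (Submodule.Quotient.mk (x ⊗ₜ[ℤ] m)) =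
      Submodule.Quotient.mk (x ⊗ₜ[ℤ] f m) := rfl

variable {S T X} in
theorem balanced_hom_ext {M : Type w} [AddCommGroup M] [Module Sᵐᵒᵖ M] {P : Type*} [AddCommGroup P]
    {f g : BalancedTensor S T X M →+ P}
    (h : ∀ (x : X) (m : M), f (Submodule.Quotient.mk (x ⊗ₜ[ℤ] m)) =
      g (Submodule.Quotient.mk (x ⊗ₜ[ℤ] m))) : f = g := by
  ext z
  obtain ⟨z, rfl⟩ := Submodule.Quotient.mk_surjective _ z
  induction z using TensorProduct.induction_on with
  | zero => rw [Submodule.Quotient.mk_zero, map_zero, map_zero]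
  | tmul x m => exact h x m
  | add a b ha hb => rw [Submodule.Quotient.mk_add, map_add, map_add, ha, hb]

/-- The functor `- ⊗_S X : Mod S ⥤ Mod T` of an `S`-`T`-bimodule `X`. -/
noncomputable def balancedTensorFunctor :
    ModuleCat.{w} Sᵐᵒᵖ ⥤ ModuleCat.{max u w} Tᵐᵒᵖ where
  obj M := ModuleCat.of Tᵐᵒᵖ (BalancedTensor S T X M)
  map f := ModuleCat.ofHom (balancedMap S T X f.hom)
  map_id M := by
    refine ModuleCat.hom_ext (LinearMap.toAddMonoidHom_injective ?_)
    exact balanced_hom_ext fun x m => rfl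
  map_comp f g := by
    refine ModuleCat.hom_ext (LinearMap.toAddMonoidHom_injective ?_)
    exact balanced_hom_ext fun x m => rfl

end Tensor

/-! ### The radical of a group action -/

section Radical

variable (R : Type u) (G : Type v) [CommRing R] [Group G] [MulSemiringAction G R]

/-- The sequences `(a₁, …, aₙ)` and `(b₁, …, bₙ)` are pertinent under the `G`-action. -/
def Pertinent {n : ℕ} (a b : Fin n → R) : Prop :=
  ∀ g : G, g ≠ 1 → ∑ i, a i * (g • b i) = 0

/-- The radical `𝔯(R, G)` of `R` under the `G`-action. -/
def radical : Ideal R where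
  carrier := {x | ∃ n : ℕ, 1 ≤ n ∧ ∃ a b : Fin n → R, Pertinent R G a b ∧ x = ∑ i, a i * b i}
  zero_mem' := ⟨1, le_rfl, 0, 0, fun g _ => by simp, by simp⟩
  add_mem' := by
    rintro _ _ ⟨n, hn, a, b, hab, rfl⟩ ⟨m, _, c, d, hcd, rfl⟩
    refine ⟨n + m, by omega, Fin.append a c, Fin.append b d, fun g hg => ?_, ?_⟩
    · simp [Fin.sum_univ_add, hab g hg, hcd g hg]
    · simp [Fin.sum_univ_add]
  smul_mem' := by
    rintro r _ ⟨n, hn, a, b, hab, rfl⟩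
    refine ⟨n, hn, fun i => r * a i, b, fun g hg => ?_, ?_⟩
    · simp [mul_assoc, ← Finset.mul_sum, hab g hg]
    · simp [mul_assoc, Finset.mul_sum]

variable {R G} in
theorem smul_mem_radical (h : G) {x : R} (hx : x ∈ radical R G) : h • x ∈ radical R G := by
  obtain ⟨n, hn, a, b, hab, rfl⟩ := hx
  refine ⟨n, hn, fun i => h • a i, fun i => h • b i, fun g hg => ?_, ?_⟩
  · have h1 : h⁻¹ * g * h ≠ 1 := fun h1 => hg (by
      rw [mul_assoc, inv_mul_eq_one] at h1
      exact mul_eq_right.1 h1.symm)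
    have := congrArg (h • ·) (hab _ h1)
    simpa [Finset.smul_sum, smul_mul', smul_smul, mul_assoc] using this
  · simp [Finset.smul_sum, smul_mul']

/-- The ideal `𝔟 = 𝔯 ⊗ 𝕜G` of the skew group algebra `B = R * G`: the elements `∑ r_g g` all of
whose coefficients `r_g` lie in `𝔯`. -/
def skewRadical : Ideal (SkewMonoidAlgebra R G) where
  carrier := {f | ∀ g, f.coeff g ∈ radical R G}
  zero_mem' g := (radical R G).zero_mem
  add_mem' ha hb g := by
    rw [SkewMonoidAlgebra.coeff_add]
    exact (radical R G).add_mem (ha g) (hb g)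
  smul_mem' c f hf g := by
    classical
    rw [smul_eq_mul, SkewMonoidAlgebra.coeff_mul_left]
    exact Submodule.sum_mem _ fun h _ => Ideal.mul_mem_left _ _ (smul_mem_radical h (hf _))

instance skewRadical_isTwoSided : (skewRadical R G).IsTwoSided where
  mul_mem_of_left {a} b ha g := by
    classical
    rw [SkewMonoidAlgebra.coeff_mul_right]
    exact Submodule.sum_mem _ fun h _ => Ideal.mul_mem_right _ _ (ha _)

end Radical

/-! ### The algebras `A = R^G` and `B = R * G` -/

section Algebras

variable (k : Type*) (R : Type u) (G : Type v) [Field k] [CommRing R] [Algebra k R] [Group G]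
  [MulSemiringAction G R] [SMulCommClass G k R]

/-- The ideal `𝔞 = 𝔯 ∩ A` of the invariant subalgebra `A = R^G`. -/
def invariantRadical : Ideal (FixedPoints.subalgebra k R G) :=
  (radical R G).comap (algebraMap (FixedPoints.subalgebra k R G) R)

instance isNoetherianRing_mulOpposite {A : Type*} [CommRing A] [IsNoetherianRing A] :
    IsNoetherianRing Aᵐᵒᵖ :=
  isNoetherianRing_of_ringEquiv A (RingEquiv.toOpposite A)

/-- The averaging operator `r ↦ |G|⁻¹ ∑ g r`. -/
noncomputable def average [Finite G] (r : R) : R :=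
  letI := Fintype.ofFinite G
  algebraMap k R (Nat.card G : k)⁻¹ * ∑ g : G, g • r

variable {R G} in
theorem average_mem [Finite G] (r : R) : average k R G r ∈ FixedPoints.subalgebra k R G := by
  intro h
  let _ := Fintype.ofFinite G
  rw [average, smul_mul', smul_algebraMap, Finset.smul_sum]
  congr 1
  exact Fintype.sum_equiv (Equiv.mulLeft h) _ _ fun g => by simp [smul_smul]

theorem average_of_fixed [Finite G] [NeZero (Nat.card G : k)] (r : R) (hr : ∀ g : G, g • r = r) :
    average k R G r = r := by
  let _ := Fintype.ofFinite G
  have h : (Nat.card G : k) ≠ 0 := NeZero.ne _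
  simp only [average, hr, Finset.sum_const, Finset.card_univ, nsmul_eq_mul,
    ← Nat.card_eq_fintype_card]
  rw [← mul_assoc, ← map_natCast (algebraMap k R), ← map_mul, inv_mul_cancel₀ h, map_one, one_mul]

/-- If `|G|` is invertible in `k`, the invariants of a noetherian algebra are noetherian. -/
instance invariants_isNoetherianRing [Finite G] [NeZero (Nat.card G : k)] [IsNoetherianRing R] :
    IsNoetherianRing (FixedPoints.subalgebra k R G) := by
  let _ := Fintype.ofFinite G
  have key : ∀ I : Ideal (FixedPoints.subalgebra k R G),
      (I.map (algebraMap (FixedPoints.subalgebra k R G) R)).comap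
        (algebraMap (FixedPoints.subalgebra k R G) R) = I := by
    intro I
    refine le_antisymm (fun x hx => ?_) Ideal.le_comap_map
    have h : ∀ y ∈ I.map (algebraMap (FixedPoints.subalgebra k R G) R),
        (⟨average k R G y, average_mem k y⟩ : FixedPoints.subalgebra k R G) ∈ I := by
      intro y hy
      rw [Ideal.map] at hy
      induction hy using Submodule.closure_induction with
      | zero =>
        convert I.zero_mem
        simp [average]
      | add a b _ _ ha hb =>
        convert I.add_mem ha hb
        simp [average, Finset.sum_add_distrib, mul_add]
      | smul_mem r z hz =>
        obtain ⟨a, ha, rfl⟩ := hz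
        convert I.mul_mem_left ⟨average k R G r, average_mem k r⟩ ha
        have h1 : ∀ g : G, g • algebraMap (FixedPoints.subalgebra k R G) R a =
          algebraMap (FixedPoints.subalgebra k R G) R a := a.2
        simp only [average, smul_eq_mul, smul_mul', h1, ← Finset.sum_mul, ← mul_assoc]
        rfl
    have := h _ hx
    convert this
    exact (average_of_fixed k R G _ x.2).symm
  rw [isNoetherianRing_iff, isNoetherian_iff']
  have hR : WellFoundedGT (Ideal R) := isNoetherian_iff'.1 inferInstance
  have hinj : Function.Injective
      (Ideal.map (algebraMap (FixedPoints.subalgebra k R G) R)) := fun I J h => by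
    rw [← key I, ← key J, h]
  exact StrictMono.wellFoundedGT (Monotone.strictMono_of_injective
    (fun I J h => Ideal.map_mono h) hinj)

theorem isNoetherianRing_of_generators {K S ι : Type*} [Ring K] [Ring S] [IsNoetherianRing K]
    [Finite ι] (φ : K →+* S) (t : ι → S)
    (h : ∀ s : S, s ∈ AddSubgroup.closure {y | ∃ (r : K) (i : ι), y = φ r * t i}) :
    IsNoetherianRing S := by
  let _ := Fintype.ofFinite ι
  let _ : Module K S := Module.compHom S φ
  have hφ : ∀ (r : K) (x : S), r • x = φ r * x := fun _ _ => rfl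
  have _ : IsScalarTower K S S := ⟨fun r x y => by simp only [hφ, smul_eq_mul, mul_assoc]⟩
  have _ : Module.Finite K S := by
    refine .of_surjective (Fintype.linearCombination K t) fun s => ?_
    rw [← LinearMap.mem_range, Fintype.range_linearCombination]
    induction h s using AddSubgroup.closure_induction with
    | mem y hy =>
      obtain ⟨r, i, rfl⟩ := hy
      exact Submodule.smul_mem _ r (Submodule.subset_span ⟨i, rfl⟩)
    | zero => exact Submodule.zero_mem _
    | add a b _ _ ha hb => exact Submodule.add_mem _ ha hb
    | neg a _ ha => exact Submodule.neg_mem _ ha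
  exact IsNoetherianRing.of_finite K S

/-- The skew group algebra of a finite group over a noetherian algebra is right noetherian. -/
instance skew_isNoetherianRing [Finite G] [IsNoetherianRing R] :
    IsNoetherianRing (SkewMonoidAlgebra R G)ᵐᵒᵖ := by
  refine isNoetherianRing_of_generators (K := Rᵐᵒᵖ)
    (SkewMonoidAlgebra.singleOneRingHom : R →+* SkewMonoidAlgebra R G).op
    (fun g : G => MulOpposite.op (SkewMonoidAlgebra.single g (1 : R))) fun f => ?_
  induction f using MulOpposite.rec' with | _ f =>
  induction f using SkewMonoidAlgebra.induction_on with
  | zero => exact AddSubgroup.zero_mem _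
  | single g r =>
    refine AddSubgroup.subset_closure ⟨MulOpposite.op (g⁻¹ • r), g, ?_⟩
    change _ = MulOpposite.op (SkewMonoidAlgebra.single g (1 : R) *
      SkewMonoidAlgebra.single 1 (g⁻¹ • r))
    rw [SkewMonoidAlgebra.single_mul_single]
    simp
  | add a b ha hb => exact AddSubgroup.add_mem _ ha hb

end Algebras

/-! ### The functor `- ⊗_B R` -/

section Functor

/-- The algebra `R` regarded as a `B`-`A`-bimodule, where `B = R * G` and `A = R^G`. -/
def Bimod (R : Type u) (_G : Type v) : Type u := R

variable (k : Type*) (R : Type u) (G : Type v) [Field k] [CommRing R] [Algebra k R] [Group G]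
  [MulSemiringAction G R] [SMulCommClass G k R]

instance : AddCommGroup (Bimod R G) := inferInstanceAs (AddCommGroup R)

/-- The identity map from `R` to `R` regarded as a bimodule. -/
def toBimod : R ≃+ Bimod R G := AddEquiv.refl R

/-- The action of `B = R * G` on `R`, in which `r g` acts by `x ↦ r (g x)`. -/
noncomputable def skewAction : SkewMonoidAlgebra R G →+* AddMonoid.End R :=
  SkewMonoidAlgebra.liftNCRingHom (Module.toAddMonoidEnd R R)
    (DistribMulAction.toAddMonoidEnd G R) fun {x y} => AddMonoidHom.ext fun z =>
      (smul_mul' y x z).symm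

variable {R G} in
theorem skewAction_single (g : G) (r x : R) :
    skewAction R G (SkewMonoidAlgebra.single g r) x = r * g • x :=
  DFunLike.congr_fun (SkewMonoidAlgebra.liftNC_single
    ((Module.toAddMonoidEnd R R : R →+* AddMonoid.End R) : R →+ AddMonoid.End R)
    (DistribMulAction.toAddMonoidEnd G R) g r) x

/-- The left `B`-module structure of `R`. -/
noncomputable instance : Module (SkewMonoidAlgebra R G) (Bimod R G) :=
  Module.compHom R (skewAction R G)

/-- The right `A`-module structure of `R`, by multiplication. -/
instance : Module (FixedPoints.subalgebra k R G)ᵐᵒᵖ (Bimod R G) :=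
  Module.compHom R (algebraMap (FixedPoints.subalgebra k R G) R).op

variable {R G} in
theorem single_smul_bimod (g : G) (r x : R) :
    SkewMonoidAlgebra.single g r • toBimod R G x = toBimod R G (r * g • x) :=
  skewAction_single g r x

theorem op_smul_bimod (a : FixedPoints.subalgebra k R G) (x : R) :
    MulOpposite.op a • toBimod R G x = toBimod R G (x * a) := rfl

instance : SMulCommClass (SkewMonoidAlgebra R G) (FixedPoints.subalgebra k R G)ᵐᵒᵖ
    (Bimod R G) where
  smul_comm b a x := by
    obtain ⟨x, rfl⟩ := (toBimod R G).surjective x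
    induction a using MulOpposite.rec' with | _ a =>
    induction b using SkewMonoidAlgebra.induction_on with
    | zero => rw [zero_smul, zero_smul, smul_zero]
    | single g r =>
      have h : g • (a : R) = a := a.2 g
      rw [single_smul_bimod, op_smul_bimod, op_smul_bimod, single_smul_bimod, smul_mul', h,
        mul_assoc]
    | add b c hb hc => rw [add_smul, hb, hc, add_smul, smul_add]

/-- The functor `- ⊗_B R : Mod B ⥤ Mod A`. -/
noncomputable def tensorFunctor :
    ModuleCat.{max u v} (SkewMonoidAlgebra R G)ᵐᵒᵖ ⥤
      ModuleCat.{max u v} (FixedPoints.subalgebra k R G)ᵐᵒᵖ :=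
  balancedTensorFunctor.{max u v, u} (SkewMonoidAlgebra R G) (FixedPoints.subalgebra k R G)
    (Bimod R G)

/-- The embedding of `A` into `B`. -/
noncomputable def invariantsHom : FixedPoints.subalgebra k R G →+* SkewMonoidAlgebra R G :=
  SkewMonoidAlgebra.singleOneRingHom.comp (algebraMap (FixedPoints.subalgebra k R G) R)

theorem invariantsHom_apply (a : FixedPoints.subalgebra k R G) :
    invariantsHom k R G a = SkewMonoidAlgebra.single (1 : G) (a : R) := rfl

section Induced

variable [Finite G]

/-- The element `x e` of `B`, where `e = |G|⁻¹ ∑ g`. -/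
noncomputable def mulIdem (x : R) : SkewMonoidAlgebra R G :=
  letI := Fintype.ofFinite G
  ∑ g : G, SkewMonoidAlgebra.single g (x * algebraMap k R (Nat.card G : k)⁻¹)

theorem mulIdem_add (x y : R) : mulIdem k R G (x + y) = mulIdem k R G x + mulIdem k R G y := by
  simp [mulIdem, add_mul, Finset.sum_add_distrib, SkewMonoidAlgebra.single_add]

theorem mul_mulIdem (b : SkewMonoidAlgebra R G) (x : R) :
    b * mulIdem k R G x = mulIdem k R G ((toBimod R G).symm (b • toBimod R G x)) := by
  induction b using SkewMonoidAlgebra.induction_on with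
  | zero => simp [mulIdem]
  | single h r =>
    let _ := Fintype.ofFinite G
    rw [single_smul_bimod, AddEquiv.symm_apply_apply, mulIdem, mulIdem, Finset.mul_sum]
    refine Fintype.sum_equiv (Equiv.mulLeft h) _ _ fun g => ?_
    rw [SkewMonoidAlgebra.single_mul_single, smul_mul', smul_algebraMap, mul_assoc,
      Equiv.coe_mulLeft]
  | add b c hb hc => rw [add_mul, hb, hc, add_smul, map_add, mulIdem_add]

theorem mulIdem_mul (x a : R) (ha : ∀ g : G, g • a = a) :
    mulIdem k R G x * SkewMonoidAlgebra.single 1 a = mulIdem k R G (x * a) := by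
  rw [mulIdem, mulIdem, Finset.sum_mul]
  refine Finset.sum_congr rfl fun g _ => ?_
  rw [SkewMonoidAlgebra.single_mul_single, ha g, mul_one, mul_right_comm]

theorem mulIdem_smul_one [NeZero (Nat.card G : k)] (x : R) :
    mulIdem k R G x • toBimod R G 1 = toBimod R G x := by
  have h : (Nat.card G : k) ≠ 0 := NeZero.ne _
  let _ := Fintype.ofFinite G
  simp only [mulIdem, Finset.sum_smul, single_smul_bimod, smul_one, mul_one, Finset.sum_const,
    Finset.card_univ, ← Nat.card_eq_fintype_card, ← map_nsmul]
  rw [nsmul_eq_mul, mul_left_comm, ← map_natCast (algebraMap k R), ← map_mul,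
    mul_inv_cancel₀ h, map_one, mul_one]

section

open TensorProduct

variable (M : Type w) [AddCommGroup M] [Module (SkewMonoidAlgebra R G)ᵐᵒᵖ M]

/-- The map `M ⊗_B R → M`, `m ⊗ x ↦ m (x e)`. -/
theorem exists_tensor_to_module :
    ∃ φ : BalancedTensor (SkewMonoidAlgebra R G) (FixedPoints.subalgebra k R G) (Bimod R G) M →+ M,
      (∀ (x : R) (m : M), φ (Submodule.Quotient.mk (toBimod R G x ⊗ₜ[ℤ] m)) =
        MulOpposite.op (mulIdem k R G x) • m) ∧
      (∀ (a : FixedPoints.subalgebra k R G) z, φ (MulOpposite.op a • z) =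
        MulOpposite.op (invariantsHom k R G a) • φ z) := by
  let _ : Module (FixedPoints.subalgebra k R G)ᵐᵒᵖ M :=
    Module.compHom M (invariantsHom k R G).op
  have hM : ∀ (a : FixedPoints.subalgebra k R G) (m : M), MulOpposite.op a • m =
    MulOpposite.op (invariantsHom k R G a) • m := fun _ _ => rfl
  let φ₀ : Bimod R G →+ M →+ M := AddMonoidHom.mk' (fun x =>
    DistribSMul.toAddMonoidHom M (MulOpposite.op (mulIdem k R G ((toBimod R G).symm x))))
    fun x y => by
      ext m
      simp [mulIdem_add, add_smul]
  let φ₁ : Bimod R G ⊗[ℤ] M →+ M := TensorProduct.liftAddHom φ₀ fun n x m => by simp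
  have hφ₁ : ∀ x m, φ₁ (toBimod R G x ⊗ₜ[ℤ] m) = MulOpposite.op (mulIdem k R G x) • m :=
    fun x m => rfl
  let φ₂ : Bimod R G ⊗[ℤ] M →ₗ[(FixedPoints.subalgebra k R G)ᵐᵒᵖ] M :=
    { φ₁ with
      map_smul' := fun a z => by
        induction a using MulOpposite.rec' with | _ a =>
        change φ₁ (MulOpposite.op a • z) = MulOpposite.op a • φ₁ z
        induction z using TensorProduct.induction_on with
        | zero => simp
        | tmul x m =>
          obtain ⟨x, rfl⟩ := (toBimod R G).surjective x
          rw [TensorProduct.smul_tmul', op_smul_bimod, hφ₁, hφ₁, hM, smul_smul,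
            invariantsHom_apply, ← MulOpposite.op_mul, mulIdem_mul _ _ _ _ _ a.2]
        | add u v hu hv => rw [smul_add, map_add, map_add, hu, hv, smul_add] }
  have hle : tensorRel (SkewMonoidAlgebra R G) (FixedPoints.subalgebra k R G) (Bimod R G) M ≤
      LinearMap.ker φ₂ := by
    rw [tensorRel, Submodule.span_le]
    rintro _ ⟨b, x, m, rfl⟩
    obtain ⟨x, rfl⟩ := (toBimod R G).surjective x
    rw [SetLike.mem_coe, LinearMap.mem_ker]
    change φ₁ ((b • toBimod R G x) ⊗ₜ[ℤ] m - toBimod R G x ⊗ₜ[ℤ] (MulOpposite.op b • m)) = 0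
    rw [map_sub, sub_eq_zero, hφ₁, smul_smul, ← MulOpposite.op_mul, mul_mulIdem, ← hφ₁,
      AddEquiv.apply_symm_apply]
  exact ⟨(Submodule.liftQ _ φ₂ hle).toAddMonoidHom, fun x m => hφ₁ x m,
    fun a z => map_smul (Submodule.liftQ _ φ₂ hle) (MulOpposite.op a) z⟩

end

theorem invariantsHom_mem (n : ℕ) (a : FixedPoints.subalgebra k R G)
    (ha : a ∈ invariantRadical k R G ^ n) : invariantsHom k R G a ∈ skewRadical R G ^ n := by
  induction n generalizing a with
  | zero => rw [Submodule.pow_zero, Ideal.one_eq_top]; trivial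
  | succ n ih =>
    rw [Ideal.IsTwoSided.pow_succ] at ha ⊢
    induction ha using Submodule.mul_induction_on' with
    | mem_mul_mem y hy z hz =>
      rw [map_mul]
      refine Ideal.mul_mem_mul (fun g => ?_) (ih z hz)
      change (Finsupp.single (1 : G) (y : R)) g ∈ _
      classical
      rw [Finsupp.single_apply]
      split_ifs
      exacts [hy, Ideal.zero_mem _]
    | add y _ z _ hy hz => rw [map_add]; exact add_mem hy hz

variable [NeZero (Nat.card G : k)] [IsNoetherianRing R]

open TensorProduct in
/-- `- ⊗_B R` sends morphisms with `𝔟`-torsion kernel and cokernel to morphisms with `𝔞`-torsion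
kernel and cokernel. -/
theorem tensorFunctor_isoModSerre {M N : ModuleCat.{max u v} (SkewMonoidAlgebra R G)ᵐᵒᵖ}
    (f : M ⟶ N) (hf : (torsion.{max u v} (skewRadical R G)).isoModSerre f) :
    (torsion.{max u v} (invariantRadical k R G)).isoModSerre ((tensorFunctor k R G).map f) := by
  rw [isoModSerre_torsion_iff] at hf ⊢
  obtain ⟨hker, hcoker⟩ := hf
  obtain ⟨φM, hφM, hφMa⟩ := exists_tensor_to_module k R G M
  obtain ⟨φN, hφN, hφNa⟩ := exists_tensor_to_module k R G N
  let F := balancedMap (SkewMonoidAlgebra R G) (FixedPoints.subalgebra k R G) (Bimod R G) f.hom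
  let ψ (P : ModuleCat.{max u v} (SkewMonoidAlgebra R G)ᵐᵒᵖ) : P →+
      BalancedTensor (SkewMonoidAlgebra R G) (FixedPoints.subalgebra k R G) (Bimod R G) P :=
    (Submodule.mkQ (tensorRel (SkewMonoidAlgebra R G) (FixedPoints.subalgebra k R G)
      (Bimod R G) P)).toAddMonoidHom.comp
        (TensorProduct.mk ℤ (Bimod R G) P (toBimod R G 1)).toAddMonoidHom
  have hψ (P : ModuleCat.{max u v} (SkewMonoidAlgebra R G)ᵐᵒᵖ) (b : SkewMonoidAlgebra R G)
      (m : P) : ψ P (MulOpposite.op b • m) =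
        Submodule.Quotient.mk ((b • toBimod R G 1) ⊗ₜ[ℤ] m) := by
    have h : (b • toBimod R G 1) ⊗ₜ[ℤ] m - toBimod R G 1 ⊗ₜ[ℤ] (MulOpposite.op b • m) ∈
        tensorRel (SkewMonoidAlgebra R G) (FixedPoints.subalgebra k R G) (Bimod R G) P :=
      Submodule.subset_span ⟨b, toBimod R G 1, m, rfl⟩
    exact ((Submodule.Quotient.eq _).2 h).symm
  have hψa (P : ModuleCat.{max u v} (SkewMonoidAlgebra R G)ᵐᵒᵖ)
      (a : FixedPoints.subalgebra k R G) (m : P) :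
      ψ P (MulOpposite.op (invariantsHom k R G a) • m) = MulOpposite.op a • ψ P m := by
    rw [hψ, invariantsHom_apply, single_smul_bimod, one_smul, mul_one]
    change _ = Submodule.Quotient.mk (MulOpposite.op a • (toBimod R G 1 ⊗ₜ[ℤ] m))
    rw [TensorProduct.smul_tmul', op_smul_bimod, one_mul]
  have hψφM : (ψ M).comp φM = AddMonoidHom.id _ := balanced_hom_ext fun x m => by
    obtain ⟨x, rfl⟩ := (toBimod R G).surjective x
    rw [AddMonoidHom.comp_apply, hφM, hψ, mulIdem_smul_one]
    rfl
  have hψφN : (ψ N).comp φN = AddMonoidHom.id _ := balanced_hom_ext fun x m => by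
    obtain ⟨x, rfl⟩ := (toBimod R G).surjective x
    rw [AddMonoidHom.comp_apply, hφN, hψ, mulIdem_smul_one]
    rfl
  have hφF : φN.comp F.toAddMonoidHom = f.hom.toAddMonoidHom.comp φM :=
    balanced_hom_ext fun x m => by
      obtain ⟨x, rfl⟩ := (toBimod R G).surjective x
      rw [AddMonoidHom.comp_apply, AddMonoidHom.comp_apply, hφM]
      exact (hφN x (f m)).trans (map_smul f.hom _ m).symm
  refine ⟨fun z hz => ?_, fun y => ?_⟩
  · have h0 : f (φM z) = 0 := by
      refine (DFunLike.congr_fun hφF z).symm.trans ?_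
      change φN (F z) = 0
      rw [show F z = 0 from hz, map_zero]
    obtain ⟨n, hn⟩ := hker _ h0
    refine ⟨n, fun a ha => ?_⟩
    have h1 := hψa M a (φM z)
    rw [hn _ (invariantsHom_mem k R G n a ha), map_zero] at h1
    exact (h1.trans (congrArg _ (DFunLike.congr_fun hψφM z))).symm
  · obtain ⟨n, hn⟩ := hcoker (φN y)
    refine ⟨n, fun a ha => ?_⟩
    obtain ⟨m, hm⟩ := hn _ (invariantsHom_mem k R G n a ha)
    refine ⟨ψ M m, ?_⟩
    have h1 := hψa N a (φN y)
    rw [← hm] at h1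
    exact h1.trans (congrArg _ (DFunLike.congr_fun hψφN y))

/-- The functor `- ⊗_𝓑 𝓡 : QMod_𝔟 B ⥤ QMod_𝔞 A` induced by `- ⊗_B R`. -/
noncomputable def quotientTensorFunctor :
    QMod.{max u v} (SkewMonoidAlgebra R G) (skewRadical R G) ⥤
      QMod.{max u v} (FixedPoints.subalgebra k R G) (invariantRadical k R G) :=
  Localization.Construction.lift
    (tensorFunctor k R G ⋙ QMod.π (FixedPoints.subalgebra k R G) (invariantRadical k R G))
    fun _ _ f hf => MorphismProperty.Q_inverts _ _ (tensorFunctor_isoModSerre k R G f hf)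

/-- The induced functor is compatible with the projections to the quotient categories. -/
theorem π_comp_quotientTensorFunctor :
    QMod.π (SkewMonoidAlgebra R G) (skewRadical R G) ⋙ quotientTensorFunctor k R G =
      tensorFunctor k R G ⋙ QMod.π (FixedPoints.subalgebra k R G) (invariantRadical k R G) :=
  Localization.Construction.fac _ _

end Induced

end Functor

/-! ### Cofinality -/

/-- For a subalgebra `A` of `R`, an ideal `𝔞` of `A` and an ideal `𝔯` of `R` are cofinal if
`𝔞R = R𝔞` and the filtrations `𝔞ⁿR` and `𝔯ⁿ` of `R` are cofinal. -/
structure Cofinal {A : Type*} {R : Type u} [CommRing A] [CommRing R] [Algebra A R]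
    (𝔞 : Ideal A) (𝔯 : Ideal R) : Prop where
  comm : AddSubgroup.closure {x : R | ∃ a ∈ 𝔞, ∃ r : R, x = algebraMap A R a * r} =
    AddSubgroup.closure {x : R | ∃ a ∈ 𝔞, ∃ r : R, x = r * algebraMap A R a}
  exists_pow_le_map : ∀ s : ℕ, ∃ n : ℕ, 𝔯 ^ n ≤ (𝔞 ^ s).map (algebraMap A R)
  exists_map_le_pow : ∀ s : ℕ, ∃ n : ℕ, (𝔞 ^ n).map (algebraMap A R) ≤ 𝔯 ^ s

end GRadical

namespace GRadical

/-! ### The right adjoint of `- ⊗_S X` -/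

section HomTensor

variable (S : Type*) (T : Type*) [Ring S] [Ring T]
variable (X : Type u) [AddCommGroup X] [Module S X] [Module Tᵐᵒᵖ X] [SMulCommClass S Tᵐᵒᵖ X]

/-! Let e = |G|⁻¹ ∑ g. It is an idempotent of B with Be ≅ R, so - ⊗_B R is the functor M ↦ Me. Its
right adjoint Hom_A(R, -) has invertible counit, because an A-linear map f with f = fe is determined
by f(1). Hence Mod B → Mod A is a localization, and so is its composite with Mod A → QMod_𝔞 A. The
induced functor is an equivalence once this composite is a localization at exactly the morphisms
with 𝔟-torsion kernel and cokernel. Those morphisms are inverted without any further hypothesis;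
what cofinality must supply is that no others are (`isoModSerre_of_tensorFunctor_map`).

The link between 𝔯 and e is that ∑ aᵢbᵢ = |G| ∑ aᵢ e bᵢ for pertinent sequences
(`single_sum_of_pertinent`), so 𝔯 lies in BeB. If yRe is 𝔞-torsion modulo a submodule K, then every
x in 𝔯 satisfies y x 𝔞ˢR ⊆ K for some s. Finite generation of 𝔯 makes s uniform, and 𝔯ⁿ ⊆ 𝔞ˢR then
gives y 𝔟ⁿ⁺¹ ⊆ K (`exists_skewRadical_pow_smul_mem`). Applied to K = 0 and to K = im f, this handles
kernels and cokernels.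

Conversely, - ⊗_B R makes B/𝔞ˢB an 𝔞-torsion module. An equivalence reflects zero objects, so B/𝔞ˢB
is 𝔟-torsion, and the class of 1 yields 𝔯ⁿ ⊆ 𝔞ˢR (`exists_radical_pow_le_map`). The rest of
cofinality is automatic, since R is commutative and 𝔞R ⊆ 𝔯. -/

/-- The right `S`-module `Hom_T(X, N)` of an `S`-`T`-bimodule `X` and a right `T`-module `N`. -/
def BimoduleHom (_S : Type*) (T : Type*) [Ring T] (X : Type u) [AddCommGroup X] [Module Tᵐᵒᵖ X]
    (N : Type w) [AddCommGroup N] [Module Tᵐᵒᵖ N] : Type (max u w) :=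
  X →ₗ[Tᵐᵒᵖ] N

namespace BimoduleHom

variable (N : Type w) [AddCommGroup N] [Module Tᵐᵒᵖ N]

instance : AddCommGroup (BimoduleHom S T X N) := inferInstanceAs (AddCommGroup (X →ₗ[Tᵐᵒᵖ] N))

instance : FunLike (BimoduleHom S T X N) X N := inferInstanceAs (FunLike (X →ₗ[Tᵐᵒᵖ] N) X N)

instance : LinearMapClass (BimoduleHom S T X N) Tᵐᵒᵖ X N :=
  inferInstanceAs (LinearMapClass (X →ₗ[Tᵐᵒᵖ] N) Tᵐᵒᵖ X N)

variable {S T X N}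

@[ext]
theorem ext {f g : BimoduleHom S T X N} (h : ∀ x, f x = g x) : f = g := DFunLike.ext _ _ h

@[simp]
theorem zero_apply (x : X) : (0 : BimoduleHom S T X N) x = 0 := rfl

instance : Module Sᵐᵒᵖ (BimoduleHom S T X N) where
  smul b f :=
    { toFun := fun x => f (b.unop • x)
      map_add' := fun x y => by rw [smul_add, map_add]
      map_smul' := fun t x => by rw [smul_comm, map_smul, RingHom.id_apply] }
  one_smul f := ext fun x => congrArg f (one_smul S x)
  mul_smul a b f := ext fun x => congrArg f (mul_smul b.unop a.unop x)
  smul_zero b := rfl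
  smul_add b f g := rfl
  add_smul a b f := ext fun x => (congrArg f (add_smul a.unop b.unop x)).trans (map_add f _ _)
  zero_smul f := ext fun x => (congrArg f (zero_smul S x)).trans (map_zero f)

@[simp]
theorem smul_apply (b : Sᵐᵒᵖ) (f : BimoduleHom S T X N) (x : X) : (b • f) x = f (b.unop • x) := rfl

end BimoduleHom

/-- The functor `Hom_T(X, -) : Mod T ⥤ Mod S` of an `S`-`T`-bimodule `X`. -/
def bimoduleHomFunctor : ModuleCat.{max u w} Tᵐᵒᵖ ⥤ ModuleCat.{max u w} Sᵐᵒᵖ where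
  obj N := ModuleCat.of Sᵐᵒᵖ (BimoduleHom S T X N)
  map g := ModuleCat.ofHom
    { toFun := fun f => g.hom.comp (f : X →ₗ[Tᵐᵒᵖ] _)
      map_add' := fun f f' => BimoduleHom.ext fun x => map_add g.hom (f x) (f' x)
      map_smul' := fun b f => rfl }

open TensorProduct

variable {S T X}

theorem mk_smul_tmul {M : Type w} [AddCommGroup M] [Module Sᵐᵒᵖ M] (b : S) (x : X) (m : M) :
    (Submodule.Quotient.mk ((b • x) ⊗ₜ[ℤ] m) : BalancedTensor S T X M) =
      Submodule.Quotient.mk (x ⊗ₜ[ℤ] (MulOpposite.op b • m)) :=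
  (Submodule.Quotient.eq _).2 (Submodule.subset_span ⟨b, x, m, rfl⟩)

section Uncurry

variable {M : Type*} [AddCommGroup M] [Module Sᵐᵒᵖ M] {N : Type*} [AddCommGroup N] [Module Tᵐᵒᵖ N]

/-- The map `M ⊗_S X → N` corresponding to a map `M → Hom_T(X, N)`. -/
noncomputable def balancedUncurry (f : M →ₗ[Sᵐᵒᵖ] BimoduleHom S T X N) :
    BalancedTensor S T X M →ₗ[Tᵐᵒᵖ] N :=
  Submodule.liftQ _
    (AlgebraTensorModule.lift
      { toFun := fun x => AddMonoidHom.toIntLinearMap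
          { toFun := fun m => f m x
            map_zero' := by rw [map_zero]; rfl
            map_add' := fun m m' => by rw [map_add]; rfl }
        map_add' := fun x y => LinearMap.ext fun m => map_add (f m) x y
        map_smul' := fun t x => LinearMap.ext fun m => map_smul (f m) t x }) <| by
    rw [tensorRel, Submodule.span_le]
    rintro _ ⟨b, x, m, rfl⟩
    rw [SetLike.mem_coe, LinearMap.mem_ker, map_sub, sub_eq_zero]
    change f m (b • x) = f (MulOpposite.op b • m) x
    rw [map_smul f]
    rfl

/-- The map `M → Hom_T(X, N)` corresponding to a map `M ⊗_S X → N`. -/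
noncomputable def balancedCurry (f : BalancedTensor S T X M →ₗ[Tᵐᵒᵖ] N) :
    M →ₗ[Sᵐᵒᵖ] BimoduleHom S T X N where
  toFun m := show X →ₗ[Tᵐᵒᵖ] N from
    { toFun := fun x => f (Submodule.Quotient.mk (x ⊗ₜ[ℤ] m))
      map_add' := fun x y => by rw [TensorProduct.add_tmul, Submodule.Quotient.mk_add, map_add]
      map_smul' := fun t x => by
        rw [← TensorProduct.smul_tmul', Submodule.Quotient.mk_smul, map_smul, RingHom.id_apply] }
  map_add' m m' := BimoduleHom.ext fun x => by
    change f (Submodule.Quotient.mk (x ⊗ₜ[ℤ] (m + m'))) =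
      f (Submodule.Quotient.mk (x ⊗ₜ[ℤ] m)) + f (Submodule.Quotient.mk (x ⊗ₜ[ℤ] m'))
    rw [TensorProduct.tmul_add, Submodule.Quotient.mk_add, map_add]
  map_smul' b m := BimoduleHom.ext fun x => congrArg f (mk_smul_tmul b.unop x m).symm

theorem balancedUncurry_balancedCurry (f : BalancedTensor S T X M →ₗ[Tᵐᵒᵖ] N) :
    balancedUncurry (balancedCurry f) = f :=
  LinearMap.toAddMonoidHom_injective (balanced_hom_ext fun _ _ => rfl)

end Uncurry

variable (S T X)

/-- The functor `- ⊗_S X` is left adjoint to `Hom_T(X, -)`. -/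
noncomputable def balancedTensorAdjunction :
    balancedTensorFunctor.{max u w, u} S T X ⊣ bimoduleHomFunctor.{w, u} S T X :=
  Adjunction.mkOfHomEquiv
    { homEquiv := fun _ _ =>
        { toFun := fun f => ModuleCat.ofHom (balancedCurry f.hom)
          invFun := fun g => ModuleCat.ofHom (balancedUncurry g.hom)
          left_inv := fun f => ModuleCat.hom_ext (balancedUncurry_balancedCurry f.hom)
          right_inv := fun _ => rfl }
      homEquiv_naturality_left_symm := fun {M' _ N} _ _ =>
        ModuleCat.hom_ext (LinearMap.toAddMonoidHom_injective
          (balanced_hom_ext (S := S) (T := T) (X := X) (M := M') (P := N) fun _ _ => rfl))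
      homEquiv_naturality_right := fun _ _ => rfl }

end HomTensor

/-! ### Powers of `𝔟` and right submodules of `B` given by ideals of `R` -/

section Skew

variable {R : Type u} {G : Type v} [CommRing R] [Group G] [MulSemiringAction G R]

theorem single_mem_skewRadical_pow (n : ℕ) {x : R} (hx : x ∈ radical R G ^ n) :
    SkewMonoidAlgebra.single (1 : G) x ∈ skewRadical R G ^ n := by
  induction n generalizing x with
  | zero => rw [Submodule.pow_zero, Ideal.one_eq_top]; trivial
  | succ n ih =>
    rw [Ideal.IsTwoSided.pow_succ] at hx ⊢
    induction hx using Submodule.mul_induction_on' with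
    | mem_mul_mem y hy z hz =>
      have h : SkewMonoidAlgebra.single (1 : G) (y * z) =
          SkewMonoidAlgebra.single 1 y * SkewMonoidAlgebra.single 1 z := by
        rw [SkewMonoidAlgebra.single_mul_single, one_smul, one_mul]
      rw [h]
      refine Ideal.mul_mem_mul (fun g => ?_) (ih hz)
      classical
      rw [SkewMonoidAlgebra.coeff_single, Finsupp.single_apply]
      split_ifs
      exacts [hy, Ideal.zero_mem _]
    | add y _ z _ hy hz => rw [SkewMonoidAlgebra.single_add]; exact add_mem hy hz

theorem smul_mem_radical_pow (n : ℕ) (g : G) {x : R} (hx : x ∈ radical R G ^ n) :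
    g • x ∈ radical R G ^ n := by
  induction n generalizing x with
  | zero => rw [Submodule.pow_zero, Ideal.one_eq_top]; trivial
  | succ n ih =>
    rw [Submodule.pow_succ] at hx ⊢
    induction hx using Submodule.mul_induction_on' with
    | mem_mul_mem y hy z hz =>
      rw [smul_mul']
      exact Ideal.mul_mem_mul (ih hy) (smul_mem_radical g hz)
    | add y _ z _ hy hz => rw [smul_add]; exact add_mem hy hz

/-- Multiplying in R * G twists coefficients by group elements, which is harmless because 𝔯ⁿ is
G-stable. With `single_mem_skewRadical_pow` this lets powers of 𝔟 be compared with powers of 𝔯. -/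
theorem coeff_mem_radical_pow (n : ℕ) {f : SkewMonoidAlgebra R G} (hf : f ∈ skewRadical R G ^ n)
    (g : G) : f.coeff g ∈ radical R G ^ n := by
  induction n generalizing f g with
  | zero => rw [Submodule.pow_zero, Ideal.one_eq_top]; trivial
  | succ n ih =>
    rw [Ideal.IsTwoSided.pow_succ] at hf ⊢
    induction hf using Submodule.mul_induction_on' with
    | mem_mul_mem y hy z hz =>
      classical
      rw [SkewMonoidAlgebra.coeff_mul_left]
      exact Submodule.sum_mem _ fun h _ =>
        Ideal.mul_mem_mul (hy h) (smul_mem_radical_pow n h (ih hz _))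
    | add y _ z _ hy hz => rw [SkewMonoidAlgebra.coeff_add]; exact add_mem hy hz

variable (G) in
/-- The right ideal of `R * G` of the elements all of whose coefficients lie in an ideal of `R`. -/
def skewExtension (J : Ideal R) :
    Submodule (SkewMonoidAlgebra R G)ᵐᵒᵖ (SkewMonoidAlgebra R G) where
  carrier := {f | ∀ g, f.coeff g ∈ J}
  add_mem' ha hb g := by
    rw [SkewMonoidAlgebra.coeff_add]
    exact J.add_mem (ha g) (hb g)
  zero_mem' _ := J.zero_mem
  smul_mem' c f hf g := by
    classical
    induction c using MulOpposite.rec' with | _ c =>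
    -- Right multiplication twists only the coefficients of `c`, so `J` need not be G-stable.
    rw [op_smul_eq_mul, SkewMonoidAlgebra.coeff_mul_left]
    exact Submodule.sum_mem _ fun h _ => J.mul_mem_right _ (hf h)

/-- The ideal of all `r` in `R` with `y r ∈ K`, for an element `y` of a right `R * G`-module and
a submodule `K`. -/
def colonIdeal {M : Type w} [AddCommGroup M] [Module (SkewMonoidAlgebra R G)ᵐᵒᵖ M]
    (K : Submodule (SkewMonoidAlgebra R G)ᵐᵒᵖ M) (y : M) : Ideal R where
  carrier := {r | MulOpposite.op (SkewMonoidAlgebra.single (1 : G) r) • y ∈ K}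
  add_mem' {a b} ha hb := by
    rw [Set.mem_ofPred_eq, SkewMonoidAlgebra.single_add, MulOpposite.op_add, add_smul]
    exact K.add_mem ha hb
  zero_mem' := by simp
  smul_mem' c r hr := by
    -- Commutativity of R moves `c` to the right of `r`, where it acts last and preserves `K`.
    have h : SkewMonoidAlgebra.single (1 : G) (c • r) =
        SkewMonoidAlgebra.single 1 r * SkewMonoidAlgebra.single 1 c := by
      rw [SkewMonoidAlgebra.single_mul_single, one_smul, one_mul, smul_eq_mul, mul_comm]
    rw [Set.mem_ofPred_eq, h, MulOpposite.op_mul, mul_smul]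
    exact K.smul_mem _ hr

/-- Each term r g of `f` is r · 1 followed by right multiplication by g, which preserves `K`. -/
theorem op_smul_mem_of_coeff_mem_colonIdeal {M : Type w} [AddCommGroup M]
    [Module (SkewMonoidAlgebra R G)ᵐᵒᵖ M] {K : Submodule (SkewMonoidAlgebra R G)ᵐᵒᵖ M} {y : M}
    {f : SkewMonoidAlgebra R G} (hf : ∀ g, f.coeff g ∈ colonIdeal K y) :
    MulOpposite.op f • y ∈ K := by
  rw [← SkewMonoidAlgebra.sum_single f, SkewMonoidAlgebra.sum_def, Finsupp.sum,
    Finset.op_sum, Finset.sum_smul]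
  refine Submodule.sum_mem _ fun g _ => ?_
  have h : SkewMonoidAlgebra.single g (f.coeff g) =
      SkewMonoidAlgebra.single 1 (f.coeff g) * SkewMonoidAlgebra.single g 1 := by
    rw [SkewMonoidAlgebra.single_mul_single, one_smul, one_mul, mul_one]
  rw [h, MulOpposite.op_mul, mul_smul]
  exact K.smul_mem _ (hf g)

end Skew

/-- Torsion is a condition on single elements, so the exponent depends on x. The largest exponent
over a finite generating set works for all of `I`, because `J` is decreasing. -/
theorem exists_mul_le_of_fg {R : Type*} [CommRing R] {I : Ideal R} (hI : I.FG) {J : ℕ → Ideal R}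
    (hJ : Antitone J) {L : Ideal R} (h : ∀ x ∈ I, ∃ s, ∀ a ∈ J s, x * a ∈ L) :
    ∃ s, I * J s ≤ L := by
  obtain ⟨T, rfl⟩ := hI
  have h' : ∀ x, ∃ s, x ∈ T → ∀ a ∈ J s, x * a ∈ L := fun x => by
    by_cases hx : x ∈ T
    · obtain ⟨s, hs⟩ := h x (Ideal.subset_span hx)
      exact ⟨s, fun _ => hs⟩
    · exact ⟨0, fun h => absurd h hx⟩
  choose s hs using h'
  refine ⟨T.sup s, Ideal.mul_le.2 fun x hx a ha => ?_⟩
  induction hx using Submodule.span_induction with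
  | mem x hx => exact hs x hx a (hJ (Finset.le_sup hx) ha)
  | zero => simp
  | add x y _ _ hx hy => rw [add_mul]; exact L.add_mem hx hy
  | smul c x _ hx => rw [smul_eq_mul, mul_assoc]; exact L.mul_mem_left c hx

/-! ### Cofinality and torsion detected by the idempotent e -/

section Invariants

variable (k : Type*) (R : Type u) (G : Type v) [Field k] [CommRing R] [Algebra k R] [Group G]
  [MulSemiringAction G R] [SMulCommClass G k R]

theorem map_invariantRadical_pow_le (s : ℕ) :
    (invariantRadical k R G ^ s).map (algebraMap (FixedPoints.subalgebra k R G) R) ≤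
      radical R G ^ s := by
  rw [Ideal.map_pow]
  exact Ideal.pow_right_mono Ideal.map_comap_le s

/-- Only this containment has content: R is commutative, and 𝔞ˢR ⊆ 𝔯ˢ because 𝔞 lies in 𝔯. -/
theorem cofinal_of_pow_le
    (h : ∀ s, ∃ n, radical R G ^ n ≤
      (invariantRadical k R G ^ s).map (algebraMap (FixedPoints.subalgebra k R G) R)) :
    Cofinal (invariantRadical k R G) (radical R G) where
  comm := by simp only [mul_comm]
  exists_pow_le_map := h
  exists_map_le_pow s := ⟨s, map_invariantRadical_pow_le k R G s⟩

open TensorProduct in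
/-- If `M 𝔞ˢ = 0`, then `(M ⊗_B R) 𝔞ˢ = 0`. -/
theorem tensorFunctor_torsion (M : ModuleCat.{max u v} (SkewMonoidAlgebra R G)ᵐᵒᵖ) (s : ℕ)
    (h : ∀ a ∈ invariantRadical k R G ^ s, ∀ m : M,
      MulOpposite.op (invariantsHom k R G a) • m = 0) :
    torsion (invariantRadical k R G) ((tensorFunctor k R G).obj M) := by
  refine fun z => ⟨s, fun a ha => ?_⟩
  have key : DistribSMul.toAddMonoidHom (BalancedTensor (SkewMonoidAlgebra R G)
      (FixedPoints.subalgebra k R G) (Bimod R G) M) (MulOpposite.op a) = 0 :=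
    balanced_hom_ext fun x m => by
      obtain ⟨x, rfl⟩ := (toBimod R G).surjective x
      -- As R is commutative, the right action of `a` on R agrees with the left action of a · 1 in
      -- B, so it can be carried across the tensor sign to `m`.
      have hx : MulOpposite.op a • toBimod R G x = invariantsHom k R G a • toBimod R G x := by
        rw [op_smul_bimod, invariantsHom_apply, single_smul_bimod, one_smul, mul_comm]
      change Submodule.Quotient.mk (MulOpposite.op a • (toBimod R G x ⊗ₜ[ℤ] m)) = 0
      rw [TensorProduct.smul_tmul', hx, mk_smul_tmul, h a ha, TensorProduct.tmul_zero,
        Submodule.Quotient.mk_zero]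
  exact DFunLike.congr_fun key z

section Finite

variable [Finite G]

theorem mulIdem_mul_mulIdem_one [NeZero (Nat.card G : k)] (x : R) :
    mulIdem k R G x * mulIdem k R G 1 = mulIdem k R G x := by
  rw [mul_mulIdem, mulIdem_smul_one, AddEquiv.symm_apply_apply]

theorem mulIdem_one_smul (x : R) :
    mulIdem k R G 1 • toBimod R G x = toBimod R G (average k R G x) := by
  let _ := Fintype.ofFinite G
  simp only [mulIdem, Finset.sum_smul, single_smul_bimod, average, one_mul, ← map_sum,
    Finset.mul_sum]

theorem average_mul (x : R) {a : R} (ha : ∀ g : G, g • a = a) :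
    average k R G (x * a) = average k R G x * a := by
  simp only [average, smul_mul', ha, ← Finset.sum_mul, mul_assoc]

theorem average_add (x y : R) :
    average k R G (x + y) = average k R G x + average k R G y := by
  simp only [average, smul_add, Finset.sum_add_distrib, mul_add]

variable {R G} in
/-- The element `∑ aᵢ bᵢ` of `𝔯` is the element `|G| ∑ aᵢ e bᵢ` of `B e B`. -/
theorem single_sum_of_pertinent [NeZero (Nat.card G : k)] {n : ℕ} {a b : Fin n → R}
    (hab : Pertinent R G a b) :
    SkewMonoidAlgebra.single (1 : G) (∑ i, a i * b i) =
      ∑ i, mulIdem k R G (Nat.card G * a i) * SkewMonoidAlgebra.single 1 (b i) := by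
  classical
  let _ := Fintype.ofFinite G
  -- The factor |G| in the statement cancels the |G|⁻¹ built into e.
  have hG : (Nat.card G : R) * algebraMap k R (Nat.card G : k)⁻¹ = 1 := by
    rw [← map_natCast (algebraMap k R), ← map_mul, mul_inv_cancel₀ (NeZero.ne _), map_one]
  have h : ∀ i, mulIdem k R G (Nat.card G * a i) * SkewMonoidAlgebra.single 1 (b i) =
      ∑ g : G, SkewMonoidAlgebra.single g (a i * g • b i) := fun i => by
    rw [mulIdem, Finset.sum_mul]
    refine Finset.sum_congr rfl fun g _ => ?_
    rw [SkewMonoidAlgebra.single_mul_single, mul_one, mul_right_comm (Nat.card G : R), hG, one_mul]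
  have hs : ∀ (g : G) (f : Fin n → R), ∑ i, SkewMonoidAlgebra.single g (f i) =
      SkewMonoidAlgebra.single g (∑ i, f i) := fun g f =>
    (map_sum (AddMonoidHom.mk' (SkewMonoidAlgebra.single g : R → SkewMonoidAlgebra R G)
      (SkewMonoidAlgebra.single_add g)) f _).symm
  simp only [h]
  rw [Finset.sum_comm]
  simp only [hs]
  -- Pertinence kills the coefficient of every g ≠ 1.
  refine Eq.trans ?_ (Fintype.sum_eq_single 1 fun g hg => ?_).symm
  · simp only [one_smul]
  · rw [hab g hg, SkewMonoidAlgebra.single_zero]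

variable {k R G}

/-- For x = ∑ aᵢbᵢ in 𝔯 and c in 𝔞ˢ one has y x c = ∑ y (|G| aᵢ e) c bᵢ. Each y (|G| aᵢ e) c lies in
`K` when s is large, and `K` absorbs the factor bᵢ. -/
theorem exists_mul_mem_colonIdeal [NeZero (Nat.card G : k)] {M : Type w} [AddCommGroup M]
    [Module (SkewMonoidAlgebra R G)ᵐᵒᵖ M] (K : Submodule (SkewMonoidAlgebra R G)ᵐᵒᵖ M) (y : M)
    (h : ∀ x : R, ∃ s : ℕ, ∀ a ∈ invariantRadical k R G ^ s,
      MulOpposite.op (invariantsHom k R G a) • MulOpposite.op (mulIdem k R G x) • y ∈ K)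
    (x : R) (hx : x ∈ radical R G) :
    ∃ s : ℕ, ∀ r ∈ (invariantRadical k R G ^ s).map
      (algebraMap (FixedPoints.subalgebra k R G) R), x * r ∈ colonIdeal K y := by
  obtain ⟨n, -, a, b, hab, rfl⟩ := hx
  choose s hs using h
  -- A common exponent for the finitely many elements y (|G| aᵢ e).
  refine ⟨Finset.univ.sup fun i => s (Nat.card G * a i), fun r hr => ?_⟩
  rw [Ideal.map] at hr
  induction hr using Submodule.span_induction with
  | mem r hr =>
    obtain ⟨c, hc, rfl⟩ := hr
    change MulOpposite.op (SkewMonoidAlgebra.single (1 : G) ((∑ i, a i * b i) * (c : R))) • y ∈ K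
    have h1 : SkewMonoidAlgebra.single (1 : G) ((∑ i, a i * b i) * (c : R)) =
        ∑ i, mulIdem k R G (Nat.card G * a i) * (invariantsHom k R G c *
          SkewMonoidAlgebra.single 1 (b i)) := by
      have h2 : ∀ i, invariantsHom k R G c * SkewMonoidAlgebra.single 1 (b i) =
          SkewMonoidAlgebra.single 1 (b i) * SkewMonoidAlgebra.single 1 (c : R) := fun i => by
        rw [invariantsHom_apply, SkewMonoidAlgebra.single_mul_single,
          SkewMonoidAlgebra.single_mul_single, one_smul, one_smul, mul_comm]
      simp only [h2, ← mul_assoc]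
      rw [← Finset.sum_mul, ← single_sum_of_pertinent k hab, SkewMonoidAlgebra.single_mul_single,
        one_smul, one_mul]
    rw [h1, Finset.op_sum, Finset.sum_smul]
    refine Submodule.sum_mem _ fun i _ => ?_
    rw [MulOpposite.op_mul, MulOpposite.op_mul, mul_smul, mul_smul]
    exact K.smul_mem _ (hs _ c (Ideal.pow_le_pow_right
      (Finset.le_sup (f := fun i => s (Nat.card G * a i)) (Finset.mem_univ i)) hc))
  | zero => rw [mul_zero]; exact Ideal.zero_mem _
  | add r t _ _ hr ht => rw [mul_add]; exact Ideal.add_mem _ hr ht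
  | smul c r _ hr => rw [smul_eq_mul, mul_left_comm]; exact Ideal.mul_mem_left _ c hr

/-- If `𝔞` and `𝔯` are cofinal and the image of `y R e` in `M / K` is `𝔞`-torsion, then the image
of `y` is `𝔟`-torsion. -/
theorem exists_skewRadical_pow_smul_mem [NeZero (Nat.card G : k)] [IsNoetherianRing R]
    (hcof : Cofinal (invariantRadical k R G) (radical R G)) {M : Type w} [AddCommGroup M]
    [Module (SkewMonoidAlgebra R G)ᵐᵒᵖ M] (K : Submodule (SkewMonoidAlgebra R G)ᵐᵒᵖ M) (y : M)
    (h : ∀ x : R, ∃ s : ℕ, ∀ a ∈ invariantRadical k R G ^ s,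
      MulOpposite.op (invariantsHom k R G a) • MulOpposite.op (mulIdem k R G x) • y ∈ K) :
    ∃ n : ℕ, ∀ b ∈ skewRadical R G ^ n, MulOpposite.op b • y ∈ K := by
  obtain ⟨s, hs⟩ := exists_mul_le_of_fg (IsNoetherian.noetherian (radical R G))
    (J := fun s => (invariantRadical k R G ^ s).map
      (algebraMap (FixedPoints.subalgebra k R G) R))
    (fun _ _ hst => Ideal.map_mono (Ideal.pow_le_pow_right hst))
    (exists_mul_mem_colonIdeal K y h)
  obtain ⟨n, hn⟩ := hcof.exists_pow_le_map s
  -- Of the n + 1 factors from 𝔯, n give an element of 𝔞ˢR; the remaining one is what `hs`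
  -- multiplies by 𝔞ˢR.
  refine ⟨n + 1, fun b hb => op_smul_mem_of_coeff_mem_colonIdeal fun g => hs ?_⟩
  have := coeff_mem_radical_pow _ hb g
  rw [Ideal.IsTwoSided.pow_succ] at this
  exact Ideal.mul_mono_right hn this

end Finite

end Invariants

/-! ### The module M ⊗_B R as Me -/

section Equivalence

variable (k : Type*) (R : Type u) (G : Type v) [Field k] [CommRing R] [Algebra k R] [Group G]
  [MulSemiringAction G R] [SMulCommClass G k R] [Finite G] [NeZero (Nat.card G : k)]

open TensorProduct

section Module

variable {M : Type w} [AddCommGroup M] [Module (SkewMonoidAlgebra R G)ᵐᵒᵖ M]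

/-- Since x = (xe) · 1 in R, the tensor m ⊗ x equals m(xe) ⊗ 1. In particular `φ` is injective. -/
theorem mk_one_tmul_of_apply {φ : BalancedTensor (SkewMonoidAlgebra R G)
      (FixedPoints.subalgebra k R G) (Bimod R G) M →+ M}
    (hφ : ∀ (x : R) (m : M), φ (Submodule.Quotient.mk (toBimod R G x ⊗ₜ[ℤ] m)) =
      MulOpposite.op (mulIdem k R G x) • m)
    (z : BalancedTensor (SkewMonoidAlgebra R G) (FixedPoints.subalgebra k R G) (Bimod R G) M) :
    z = Submodule.Quotient.mk (toBimod R G 1 ⊗ₜ[ℤ] φ z) := by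
  obtain ⟨z, rfl⟩ := Submodule.Quotient.mk_surjective _ z
  induction z using TensorProduct.induction_on with
  | zero => rw [Submodule.Quotient.mk_zero, map_zero, TensorProduct.tmul_zero,
      Submodule.Quotient.mk_zero]
  | tmul x m =>
    obtain ⟨x, rfl⟩ := (toBimod R G).surjective x
    rw [hφ, ← mk_smul_tmul, mulIdem_smul_one]
  | add a b ha hb =>
    rw [Submodule.Quotient.mk_add, map_add, TensorProduct.tmul_add, Submodule.Quotient.mk_add,
      ← ha, ← hb]

/-- Together with the injectivity of `φ`, this identifies M ⊗_B R with a subgroup of Me. -/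
theorem op_mulIdem_one_smul_apply {φ : BalancedTensor (SkewMonoidAlgebra R G)
      (FixedPoints.subalgebra k R G) (Bimod R G) M →+ M}
    (hφ : ∀ (x : R) (m : M), φ (Submodule.Quotient.mk (toBimod R G x ⊗ₜ[ℤ] m)) =
      MulOpposite.op (mulIdem k R G x) • m)
    (z : BalancedTensor (SkewMonoidAlgebra R G) (FixedPoints.subalgebra k R G) (Bimod R G) M) :
    MulOpposite.op (mulIdem k R G 1) • φ z = φ z := by
  rw [← hφ, ← mk_one_tmul_of_apply k R G hφ]

end Module

/-! ### Full faithfulness of Hom_A(R, -) -/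

section Counit

variable (N : ModuleCat.{max u v} (FixedPoints.subalgebra k R G)ᵐᵒᵖ)

/-- The map `R → N`, `x ↦ n · |G|⁻¹ ∑ g x`. -/
noncomputable def averageHom (n : N) :
    BimoduleHom (SkewMonoidAlgebra R G) (FixedPoints.subalgebra k R G) (Bimod R G) N :=
  show Bimod R G →ₗ[(FixedPoints.subalgebra k R G)ᵐᵒᵖ] N from
  { toFun := fun x => MulOpposite.op (⟨average k R G ((toBimod R G).symm x), average_mem k _⟩ :
      FixedPoints.subalgebra k R G) • n
    map_add' := fun x y => by
      rw [← add_smul, ← MulOpposite.op_add]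
      congr 2
      exact Subtype.ext (average_add k R G _ _)
    map_smul' := fun a x => by
      rw [RingHom.id_apply, smul_smul]
      congr 1
      refine MulOpposite.unop_injective (Subtype.ext ?_)
      exact average_mul k R G _ a.unop.2 }

theorem averageHom_one (n : N) : averageHom k R G N n (toBimod R G 1) = n := by
  have h : (⟨average k R G 1, average_mem k _⟩ : FixedPoints.subalgebra k R G) = 1 :=
    Subtype.ext (average_of_fixed k R G 1 smul_one)
  change MulOpposite.op (⟨average k R G 1, average_mem k _⟩ : FixedPoints.subalgebra k R G) • n = n
  rw [h, MulOpposite.op_one, one_smul]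

/-- The adjunction between `- ⊗_B R` and `Hom_A(R, -)`. -/
noncomputable def tensorAdjunction :
    tensorFunctor k R G ⊣ bimoduleHomFunctor.{max u v, u} (SkewMonoidAlgebra R G)
      (FixedPoints.subalgebra k R G) (Bimod R G) :=
  balancedTensorAdjunction.{max u v, u} _ _ _

/-- The counit is evaluation, f ⊗ x ↦ f(x). It is onto because averaging followed by a ↦ na sends 1
to n. It is injective because every tensor is f ⊗ 1 with f = fe, and such an f vanishes as soon as
f(1) = 0. -/
theorem tensorAdjunction_counit_app_bijective :
    Function.Bijective ((tensorAdjunction k R G).counit.app N) := by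
  have hc (x : Bimod R G) (f : BimoduleHom (SkewMonoidAlgebra R G)
      (FixedPoints.subalgebra k R G) (Bimod R G) N) :
      (tensorAdjunction k R G).counit.app N (Submodule.Quotient.mk (x ⊗ₜ[ℤ] f) :
        BalancedTensor (SkewMonoidAlgebra R G) (FixedPoints.subalgebra k R G) (Bimod R G)
          (BimoduleHom (SkewMonoidAlgebra R G) (FixedPoints.subalgebra k R G) (Bimod R G) N)) =
        f x := rfl
  refine ⟨(injective_iff_map_eq_zero _).2 fun z hz => ?_, fun n =>
    ⟨_, (hc (toBimod R G 1) (averageHom k R G N n)).trans (averageHom_one k R G N n)⟩⟩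
  obtain ⟨φ, hφ, -⟩ := exists_tensor_to_module k R G
    (BimoduleHom (SkewMonoidAlgebra R G) (FixedPoints.subalgebra k R G) (Bimod R G) N)
  have hz1 := mk_one_tmul_of_apply k R G hφ z
  have h1 : φ z (toBimod R G 1) = 0 := by
    rw [← hc, ← hz1]
    exact hz
  -- Writing f for `φ z`, f(x) = (fe)(x) = f(ex), and ex is the average of x, an element of A; so
  -- f(x) = f(1) · ex = 0.
  have h2 : φ z = 0 := BimoduleHom.ext fun x => by
    obtain ⟨x, rfl⟩ := (toBimod R G).surjective x
    have h3 : toBimod R G (average k R G x) = MulOpposite.op (⟨average k R G x, average_mem k _⟩ :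
        FixedPoints.subalgebra k R G) • toBimod R G 1 := by
      rw [op_smul_bimod, one_mul]
    refine (DFunLike.congr_fun (op_mulIdem_one_smul_apply k R G hφ z).symm _).trans ?_
    rw [BimoduleHom.smul_apply, MulOpposite.unop_op, mulIdem_one_smul, h3, map_smul, h1, smul_zero,
      BimoduleHom.zero_apply]
  rw [hz1, h2, TensorProduct.tmul_zero]
  exact Submodule.Quotient.mk_zero _

instance : IsIso (tensorAdjunction k R G).counit :=
  have _ (N) : IsIso ((tensorAdjunction k R G).counit.app N) :=
    (ConcreteCategory.isIso_iff_bijective _).2 (tensorAdjunction_counit_app_bijective k R G N)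
  NatIso.isIso_of_isIso_app _

end Counit

/-! ### The two implications -/

variable [IsNoetherianRing R]

variable {k R G} in
/-- Under cofinality, `- ⊗_B R` reflects morphisms with torsion kernel and cokernel. -/
theorem isoModSerre_of_tensorFunctor_map
    (hcof : Cofinal (invariantRadical k R G) (radical R G))
    {M N : ModuleCat.{max u v} (SkewMonoidAlgebra R G)ᵐᵒᵖ} (f : M ⟶ N)
    (hf : (torsion.{max u v} (invariantRadical k R G)).isoModSerre
      ((tensorFunctor k R G).map f)) :
    (torsion.{max u v} (skewRadical R G)).isoModSerre f := by
  rw [isoModSerre_torsion_iff] at hf ⊢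
  obtain ⟨hker, hcoker⟩ := hf
  obtain ⟨φM, hφM, hφMa⟩ := exists_tensor_to_module k R G M
  obtain ⟨φN, hφN, hφNa⟩ := exists_tensor_to_module k R G N
  let F := balancedMap (SkewMonoidAlgebra R G) (FixedPoints.subalgebra k R G) (Bimod R G) f.hom
  have hφF (z) : φN (F z) = f (φM z) :=
    DFunLike.congr_fun (f := φN.comp F.toAddMonoidHom) (g := f.hom.toAddMonoidHom.comp φM)
      (balanced_hom_ext fun x m => by
        obtain ⟨x, rfl⟩ := (toBimod R G).surjective x
        rw [AddMonoidHom.comp_apply, AddMonoidHom.comp_apply, hφM]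
        exact (hφN x (f m)).trans (map_smul f.hom _ m).symm) z
  refine ⟨fun m hm => ?_, fun y => ?_⟩
  -- For m in the kernel of `f`, all m ⊗ x lie in the kernel of f ⊗ R, so mRe is 𝔞-torsion.
  · refine exists_skewRadical_pow_smul_mem hcof ⊥ m fun x => ?_
    have h0 : F (Submodule.Quotient.mk (toBimod R G x ⊗ₜ[ℤ] m)) = 0 := by
      rw [balancedMap_mk_tmul, show f.hom m = 0 from hm, TensorProduct.tmul_zero,
        Submodule.Quotient.mk_zero]
    obtain ⟨s, hs⟩ := hker _ h0
    refine ⟨s, fun a ha => ?_⟩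
    rw [← hφM, ← hφMa, Submodule.mem_bot]
    exact (congrArg φM (hs a ha)).trans (map_zero φM)
  -- The same criterion modulo the image of `f` gives the cokernel.
  · obtain ⟨n, hn⟩ := exists_skewRadical_pow_smul_mem hcof (LinearMap.range f.hom) y fun x => by
      obtain ⟨s, hs⟩ := hcoker (Submodule.Quotient.mk (toBimod R G x ⊗ₜ[ℤ] y) :
        BalancedTensor (SkewMonoidAlgebra R G) (FixedPoints.subalgebra k R G) (Bimod R G) N)
      refine ⟨s, fun a ha => ?_⟩
      obtain ⟨z, hz⟩ := hs a ha
      rw [← hφN, ← hφNa]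
      exact ⟨φM z, (hφF z).symm.trans (congrArg φN hz)⟩
    exact ⟨n, fun b hb => hn b hb⟩

variable {k R G} in
/-- Under cofinality, `Mod B ⥤ QMod_𝔞 A` is a localization functor at the morphisms with
`𝔟`-torsion kernel and cokernel. -/
theorem isLocalization_tensorFunctor_comp_π
    (hcof : Cofinal (invariantRadical k R G) (radical R G)) :
    (tensorFunctor k R G ⋙ QMod.π (FixedPoints.subalgebra k R G)
      (invariantRadical k R G)).IsLocalization
        (torsion.{max u v} (skewRadical R G)).isoModSerre := by
  let adj := tensorAdjunction k R G
  have _ := adj.fullyFaithfulROfIsIsoCounit.full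
  have _ := adj.fullyFaithfulROfIsIsoCounit.faithful
  -- A left adjoint of a fully faithful functor is a localization at the morphisms it inverts.
  have _ := adj.isLocalization
  refine Functor.IsLocalization.comp (tensorFunctor k R G)
    (QMod.π (FixedPoints.subalgebra k R G) (invariantRadical k R G))
    ((MorphismProperty.isomorphisms _).inverseImage (tensorFunctor k R G))
    (torsion.{max u v} (invariantRadical k R G)).isoModSerre _
    (fun _ _ f hf => MorphismProperty.Q_inverts _ _ (tensorFunctor_isoModSerre k R G f hf))
    (fun _ _ f hf => ?_) (fun X Y f hf => ?_)
  · have _ : IsIso ((tensorFunctor k R G).map f) := hf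
    exact isoModSerre_of_tensorFunctor_map hcof f
      ((torsion.{max u v} (invariantRadical k R G)).isoModSerre_of_isIso _)
  -- Through the counit, every morphism of Mod A is isomorphic to the image of one in Mod B; the
  -- reflection lemma puts that one in the required class.
  · let e : Arrow.mk ((tensorFunctor k R G).map ((bimoduleHomFunctor _ _ _).map f)) ≅
        Arrow.mk f :=
      Arrow.isoMk (asIso (adj.counit.app X)) (asIso (adj.counit.app Y))
        (adj.counit.naturality f).symm
    refine ⟨_, _, (bimoduleHomFunctor _ _ _).map f, ?_, ⟨e⟩⟩
    exact isoModSerre_of_tensorFunctor_map hcof _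
      ((MorphismProperty.arrow_mk_iso_iff _ e).2 hf)

variable {k R G} in
-- Torsion modules are the ones that become zero in the quotient category, and a fully faithful
-- functor reflects zero objects.
theorem torsion_of_tensorFunctor_torsion [(quotientTensorFunctor k R G).IsEquivalence]
    (M : ModuleCat.{max u v} (SkewMonoidAlgebra R G)ᵐᵒᵖ)
    (hM : torsion (invariantRadical k R G) ((tensorFunctor k R G).obj M)) :
    torsion (skewRadical R G) M := by
  rw [← ObjectProperty.SerreClassLocalization.isZero_obj_iff
    (QMod.π (FixedPoints.subalgebra k R G) (invariantRadical k R G)) (torsion _)] at hM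
  rw [← ObjectProperty.SerreClassLocalization.isZero_obj_iff
    (QMod.π (SkewMonoidAlgebra R G) (skewRadical R G)) (torsion _)]
  have h : (quotientTensorFunctor k R G).obj ((QMod.π _ _).obj M) =
      (QMod.π _ _).obj ((tensorFunctor k R G).obj M) :=
    Functor.congr_obj (π_comp_quotientTensorFunctor k R G) M
  rw [← h] at hM
  exact Limits.IsZero.of_full_of_faithful_of_isZero (quotientTensorFunctor k R G) _ hM

variable {k R G} in
-- The test module is B/JB with J = 𝔞ˢR: it is killed by 𝔞ˢ, hence must be 𝔟-torsion.
theorem exists_radical_pow_le_map [(quotientTensorFunctor k R G).IsEquivalence] (s : ℕ) :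
    ∃ n : ℕ, radical R G ^ n ≤ (invariantRadical k R G ^ s).map
      (algebraMap (FixedPoints.subalgebra k R G) R) := by
  let J := (invariantRadical k R G ^ s).map (algebraMap (FixedPoints.subalgebra k R G) R)
  have hM := torsion_of_tensorFunctor_torsion (k := k) (ModuleCat.of (SkewMonoidAlgebra R G)ᵐᵒᵖ
    (SkewMonoidAlgebra R G ⧸ skewExtension G J)) <| by
      refine tensorFunctor_torsion k R G _ s fun a ha m => ?_
      obtain ⟨f, rfl⟩ := Submodule.Quotient.mk_surjective _ m
      refine (Submodule.Quotient.mk_eq_zero _).2 fun g => ?_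
      classical
      change (f * invariantsHom k R G a).coeff g ∈ J
      -- Right multiplication by `a` multiplies the g-th coefficient by g(a), which is `a` by
      -- invariance.
      rw [invariantsHom_apply, SkewMonoidAlgebra.coeff_mul_single_one,
        a.2 g]
      exact J.mul_mem_left _ (Ideal.mem_map_of_mem _ ha)
  -- If 𝔟ⁿ kills the class of 1, then 𝔟ⁿ has its coefficients in J; the elements x · 1 with x in 𝔯ⁿ
  -- give the claim.
  obtain ⟨n, hn⟩ := hM (Submodule.Quotient.mk 1)
  refine ⟨n, fun x hx => ?_⟩
  have h : (1 * SkewMonoidAlgebra.single (1 : G) x).coeff 1 ∈ J :=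
    (Submodule.Quotient.mk_eq_zero _).1 (hn _ (single_mem_skewRadical_pow n hx)) 1
  rwa [one_mul, SkewMonoidAlgebra.coeff_single, Finsupp.single_eq_same] at h

end Equivalence

end GRadical

theorem mainTheorem4 {k : Type w} {R : Type u} {G : Type v} [Field k] [CommRing R]
    [IsNoetherianRing R] [Algebra k R] [Group G] [Finite G] [NeZero (Nat.card G : k)]
    [MulSemiringAction G R] [SMulCommClass G k R] :
    (GRadical.quotientTensorFunctor k R G).IsEquivalence ↔
      GRadical.Cofinal (GRadical.invariantRadical k R G) (GRadical.radical R G) :=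
  ⟨fun _ => GRadical.cofinal_of_pow_le k R G GRadical.exists_radical_pow_le_map,
    -- A functor is a localization when the functor it induces on the constructed localization is an
    -- equivalence, and that induced functor is `quotientTensorFunctor`.
    fun h => (GRadical.isLocalization_tensorFunctor_comp_π h).isEquivalence⟩
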